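/- Let $p$ be a complex number with $|p|<1$. For $z\in\mathbb{C}\setminus\{0\}$ put $$\theta(z;p)=\prod_{j=0}^{\infty}(1-zp^j)\Bigl(1-\frac{p^{j+1}}{z}\Bigr),$$ and for $x\in\mathbb{C}\setminus\{0\}$ and $n\ge 0$ define the elliptic $q$-shifted factorial $$(x;q,p)_n=\prod_{j=0}^{n-1}\theta(xq^j;p).$$ **Lemma 3.1 (Elliptic WP Bailey transform).** Let $a,k,q$ be nonzero complex numbers that are generic in the sense that $\theta(q^{j+1};p)\neq0$, $\theta(aq^j;p)\neq0$ and $\theta(kq^j;p)\neq 0$ for all integers $j\ge0$. Let $\alpha=(\alpha_n)_{n\ge0}$ and $\beta=(\beta_n)_{n\ge0}$ be sequences of complex numbers (which may depend on $a,k,q,p$). Then the following two statements are equivalent: (3.3a) for all integers $n\ge 0$, $$\beta_n=\sum_{r=0}^n \frac{(k/a;q,p)_{n-r}}{(q;q,p)_{n-r}}\,\frac{(k;q,p)_{n+r}}{(aq;q,p)_{n+r}}\,\alpha_r;$$ (3.3b) for all integers $n\ge 0$, $$\alpha_n=\frac{\theta(aq^{2n};p)}{\theta(a;p)}\sum_{r=0}^n\frac{\theta(kq^{2r};p)}{\theta(k;p)}\,\frac{(a/k;q,p)_{n-r}}{(q;q,p)_{n-r}}\,\frac{(a;q,p)_{n+r}}{(kq;q,p)_{n+r}}\Bigl(\frac{k}{a}\Bigr)^{n-r}\beta_r.$$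 -/

import Mathlib

open Finset

/-- The modified Jacobi theta function
`θ(z;p) = ∏_{j ≥ 0} (1 - z p^j) (1 - p^(j+1) / z)`, for `‖p‖ < 1` and `z ≠ 0`. -/
noncomputable def ellTheta (z p : ℂ) : ℂ :=
  ∏' j : ℕ, (1 - z * p ^ j) * (1 - p ^ (j + 1) / z)

/-- The elliptic `q`-shifted factorial `(a;q,p)_n = ∏_{j=0}^{n-1} θ(a q^j; p)`. -/
noncomputable def ellFactorial (a q p : ℂ) (n : ℕ) : ℂ :=
  ∏ j ∈ range n, ellTheta (a * q ^ j) p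

/-- The infinite product that defines the theta function converges when `‖p‖ < 1`. -/
theorem ellTheta_multipliable (z p : ℂ) (hp : ‖p‖ < 1) :
    Multipliable fun j : ℕ => (1 - z * p ^ j) * (1 - p ^ (j + 1) / z) := by
  have hs : Summable fun j : ℕ => ‖p‖ ^ j :=
    summable_geometric_of_lt_one (norm_nonneg p) hp
  have h1 : Multipliable fun j : ℕ => 1 + (-(z * p ^ j)) := by
    apply multipliable_one_add_of_summable
    simpa [norm_mul, norm_pow] using hs.mul_left ‖z‖
  have h2 : Multipliable fun j : ℕ => 1 + (-(p ^ (j + 1) / z)) := by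
    apply multipliable_one_add_of_summable
    have h := hs.mul_left (‖p‖ / ‖z‖)
    refine h.congr fun j => ?_
    rw [norm_neg, norm_div, norm_pow, pow_succ]
    ring
  simpa [sub_eq_add_neg] using h1.mul h2

/-! The two statements read `β = F α` and `α = G β` with `F`, `G` lower triangular, so it suffices
that `G F = 1` (`triangular_inversion`). The entry of `G F` at `(m + N, m)` is a terminating
very-well-poised sum; for `N > 0` its partial sums have a closed form with a factor `θ(q^j)`, which
becomes `θ(1) = 0` at the last index (`sum_baileyTerm_eq_zero`).

Each telescoping step is an instance of the addition formula `ellTheta_addition`. By the Jacobi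
triple product, `θ` is a constant times a bilateral series. Splitting the double series for `θ(xy)
θ(x/y)` by parity gives `C² x (A(x) B(y) - B(x) A(y))`, and the addition formula is then the Plücker
relation between 2 × 2 determinants. -/

/-! ### The bilateral theta series and its convergence. -/

/-- The general term `p^(k(k-1)/2) w^k` of the bilateral theta series. -/
noncomputable def thetaTerm (p w : ℂ) (k : ℤ) : ℂ := p ^ (k * (k - 1) / 2) * w ^ k

theorem two_mul_triangle (k : ℤ) : 2 * (k * (k - 1) / 2) = k * (k - 1) :=
  Int.two_mul_ediv_two_of_even (Int.even_mul_pred_self k)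

theorem thetaTerm_add_one {p w : ℂ} (hp : p ≠ 0) (hw : w ≠ 0) (k : ℤ) :
    thetaTerm p w (k + 1) = w * p ^ k * thetaTerm p w k := by
  have h : (k + 1) * (k + 1 - 1) / 2 = k + k * (k - 1) / 2 := by
    have h1 := two_mul_triangle k
    have h2 := two_mul_triangle (k + 1)
    have h3 : (k + 1) * (k + 1 - 1) = 2 * k + k * (k - 1) := by ring
    omega
  rw [thetaTerm, thetaTerm, h, zpow_add₀ hp, zpow_add₀ hw, zpow_one]
  ring

theorem thetaTerm_ne_zero {p w : ℂ} (hp : p ≠ 0) (hw : w ≠ 0) (k : ℤ) :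
    thetaTerm p w k ≠ 0 :=
  mul_ne_zero (zpow_ne_zero _ hp) (zpow_ne_zero _ hw)

theorem summable_of_ratio_eq_mul_pow {f : ℕ → ℂ} {c p : ℂ} (hp : ‖p‖ < 1) (hf : ∀ n, f n ≠ 0)
    (h : ∀ n, f (n + 1) = c * p ^ n * f n) : Summable f := by
  refine summable_of_ratio_test_tendsto_lt_one (l := 0) zero_lt_one (.of_forall hf) ?_
  have h1 : (fun n => ‖f (n + 1)‖ / ‖f n‖) = fun n => ‖c * p ^ n‖ := by
    funext n
    rw [h, norm_mul, mul_div_assoc, div_self (norm_ne_zero_iff.2 (hf n)), mul_one]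
  rw [h1]
  simpa using ((tendsto_pow_atTop_nhds_zero_of_norm_lt_one hp).const_mul c).norm

theorem summable_thetaTerm {p w : ℂ} (hp : p ≠ 0) (hp1 : ‖p‖ < 1) (hw : w ≠ 0) :
    Summable (thetaTerm p w) := by
  refine .of_nat_of_neg ?_ ?_
  · refine summable_of_ratio_eq_mul_pow (c := w) hp1 (fun n => thetaTerm_ne_zero hp hw _) ?_
    intro n
    rw [Nat.cast_add, Nat.cast_one, thetaTerm_add_one hp hw, zpow_natCast]
  -- The recurrence read backwards: the term at `-(n+1)` is `p^(n+1) / w` times the term at `-n`.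
  · refine summable_of_ratio_eq_mul_pow (c := p / w) hp1 (fun n => thetaTerm_ne_zero hp hw _) ?_
    intro n
    have h := thetaTerm_add_one hp hw (-((n + 1 : ℕ) : ℤ))
    have h1 : -((n + 1 : ℕ) : ℤ) + 1 = -(n : ℤ) := by push_cast; ring
    rw [h1, zpow_neg, zpow_natCast] at h
    rw [h]
    field_simp
    ring

/-! ### The Jacobi triple product, from its finite form. -/

/-- The reciprocal of `(p;p)_m`, extended by zero to negative `m`. -/
noncomputable def recipEuler (p : ℂ) (m : ℤ) : ℂ :=
  if m < 0 then 0 else (∏ j ∈ range m.toNat, (1 - p ^ (j + 1)))⁻¹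

theorem one_sub_pow_succ_ne_zero {p : ℂ} (hp1 : ‖p‖ < 1) (j : ℕ) : 1 - p ^ (j + 1) ≠ 0 := by
  intro h
  have h1 : ‖p ^ (j + 1)‖ = 1 := by rw [← sub_eq_zero.1 h, norm_one]
  rw [norm_pow] at h1
  exact (pow_lt_one₀ (norm_nonneg p) hp1 j.succ_ne_zero).ne h1

/-- Extension by zero makes this hold for every integer `m`: at `m = 0` the factor `1 - p^0`
vanishes. -/
theorem recipEuler_sub_one {p : ℂ} (hp1 : ‖p‖ < 1) (m : ℤ) :
    recipEuler p (m - 1) = (1 - p ^ m) * recipEuler p m := by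
  rcases lt_trichotomy m 0 with h | h | h
  · rw [recipEuler, recipEuler, if_pos h, if_pos (by omega), mul_zero]
  · subst h
    simp [recipEuler]
  · obtain ⟨n, rfl⟩ : ∃ n : ℕ, m = n + 1 := ⟨(m - 1).toNat, by omega⟩
    have h1 : ((n : ℤ) + 1 - 1).toNat = n := by omega
    have h2 : ((n : ℤ) + 1).toNat = n + 1 := by omega
    rw [recipEuler, recipEuler, if_neg (by omega), if_neg (by omega), h1, h2, prod_range_succ,
      mul_inv, mul_left_comm]
    have h3 := one_sub_pow_succ_ne_zero hp1 n
    have h4 : p ^ ((n : ℤ) + 1) = p ^ (n + 1) := by exact_mod_cast zpow_natCast p (n + 1)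
    rw [h4, mul_inv_cancel₀ h3, mul_one]

/-- The central `p`-binomial coefficient `(p;p)_{2N} / ((p;p)_{N+k} (p;p)_{N-k})`. -/
noncomputable def centralQBinom (p : ℂ) (N : ℕ) (k : ℤ) : ℂ :=
  (∏ j ∈ range (2 * N), (1 - p ^ (j + 1))) * recipEuler p (N + k) * recipEuler p (N - k)

theorem centralQBinom_zero (p : ℂ) (k : ℤ) : centralQBinom p 0 k = if k = 0 then 1 else 0 := by
  rcases lt_trichotomy k 0 with h | h | h
  · simp [centralQBinom, recipEuler, h, h.ne]
  · simp [centralQBinom, recipEuler, h]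
  · simp [centralQBinom, recipEuler, h, h.ne']

/-- Coefficient form of multiplication by `(1 - z p^N)(1 - p^(N+1)/z) = 1 + p^(2N+1) - z p^N -
p^(N+1)/z`. All reciprocals reduce to those at `N + 1 ± k`, leaving a rational identity. -/
theorem centralQBinom_succ {p : ℂ} (hp : p ≠ 0) (hp1 : ‖p‖ < 1) (N : ℕ) (k : ℤ) :
    centralQBinom p (N + 1) k = (1 + p ^ (2 * N + 1)) * centralQBinom p N k
      + p ^ N * p ^ (1 - k) * centralQBinom p N (k - 1)
      + p ^ (N + 1) * p ^ k * centralQBinom p N (k + 1) := by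
  have e1 : recipEuler p (N + k) = (1 - p ^ (N + 1 + k : ℤ)) * recipEuler p (N + 1 + k) := by
    rw [← recipEuler_sub_one hp1]; congr 1; ring
  have e2 : recipEuler p (N - k) = (1 - p ^ (N + 1 - k : ℤ)) * recipEuler p (N + 1 - k) := by
    rw [← recipEuler_sub_one hp1]; congr 1; ring
  have e3 : recipEuler p (N + (k - 1)) = (1 - p ^ (N + k : ℤ)) * recipEuler p (N + k) := by
    rw [← recipEuler_sub_one hp1]; congr 1; ring
  have e4 : recipEuler p (N - (k + 1)) = (1 - p ^ (N - k : ℤ)) * recipEuler p (N - k) := by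
    rw [← recipEuler_sub_one hp1]; congr 1; ring
  have e5 : (N - (k - 1) : ℤ) = N + 1 - k := by ring
  have e6 : (N + (k + 1) : ℤ) = N + 1 + k := by ring
  have e7 : 2 * (N + 1) = 2 * N + 1 + 1 := by ring
  simp only [centralQBinom, e3, e4, e5, e6, e7, prod_range_succ]
  rw [e1, e2]
  push_cast
  have hk : p ^ k ≠ 0 := zpow_ne_zero k hp
  have z1 : p ^ (N + 1 + k : ℤ) = p ^ N * p * p ^ k := by
    rw [zpow_add₀ hp, zpow_add_one₀ hp, zpow_natCast]
  have z2 : p ^ (N + 1 - k : ℤ) = p ^ N * p / p ^ k := by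
    rw [zpow_sub₀ hp, zpow_add_one₀ hp, zpow_natCast]
  have z3 : p ^ (N + k : ℤ) = p ^ N * p ^ k := by rw [zpow_add₀ hp, zpow_natCast]
  have z4 : p ^ (N - k : ℤ) = p ^ N / p ^ k := by rw [zpow_sub₀ hp, zpow_natCast]
  have z5 : p ^ (1 - k : ℤ) = p / p ^ k := by rw [zpow_sub₀ hp, zpow_one]
  rw [z1, z2, z3, z4, z5]
  generalize recipEuler p (N + 1 + k) = A
  generalize recipEuler p (N + 1 - k) = B
  have z6 : p ^ (2 * N + 1) = p ^ N * p ^ N * p := by ring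
  have z7 : p ^ (2 * N + 1 + 1) = p ^ N * p ^ N * p * p := by ring
  have z8 : p ^ (N + 1) = p ^ N * p := by ring
  rw [z6, z7, z8]
  generalize p ^ k = b at *
  generalize p ^ N = c at *
  field_simp
  ring

/-- The finite form of the Jacobi triple product identity. -/
theorem hasSum_thetaTerm_mul_centralQBinom {p z : ℂ} (hp : p ≠ 0) (hp1 : ‖p‖ < 1) (hz : z ≠ 0)
    (N : ℕ) :
    HasSum (fun k : ℤ => thetaTerm p (-z) k * centralQBinom p N k)
      (∏ j ∈ range N, (1 - z * p ^ j) * (1 - p ^ (j + 1) / z)) := by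
  have hz' : -z ≠ 0 := neg_ne_zero.2 hz
  induction N with
  | zero =>
    rw [range_zero, prod_empty]
    convert hasSum_ite_eq (0 : ℤ) (1 : ℂ) using 1
    funext k
    rw [centralQBinom_zero]
    split_ifs with h
    · simp [thetaTerm, h]
    · simp
  | succ N ih =>
    have s1 := (Equiv.subRight (1 : ℤ)).hasSum_iff.2 ih
    have s2 := (Equiv.addRight (1 : ℤ)).hasSum_iff.2 ih
    simp only [Function.comp_def, Equiv.subRight_apply, Equiv.coe_addRight] at s1 s2
    have s := ((ih.mul_left (1 + p ^ (2 * N + 1))).add (s1.mul_left (-z * p ^ N))).add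
      (s2.mul_left (-p ^ (N + 1) / z))
    rw [prod_range_succ]
    refine (eq_iff_iff.1 (congrArg₂ (fun f v => HasSum f v) (funext fun k => ?_) ?_)).2 s
    · have h1 := thetaTerm_add_one hp hz' (k - 1)
      rw [sub_add_cancel] at h1
      rw [centralQBinom_succ hp hp1, thetaTerm_add_one hp hz', h1]
      have hk : p ^ k ≠ 0 := zpow_ne_zero k hp
      rw [zpow_sub₀ hp, zpow_sub₀ hp, zpow_one]
      generalize thetaTerm p (-z) (k - 1) = T
      field_simp
      ring
    · have z6 : p ^ (2 * N + 1) = p ^ N * p ^ N * p := by ring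
      rw [z6]
      field_simp
      ring

theorem exists_tendsto_prod_one_sub_pow {p : ℂ} (hp1 : ‖p‖ < 1) :
    ∃ Q : ℂ, Q ≠ 0 ∧
      Filter.Tendsto (fun n : ℕ => ∏ j ∈ range n, (1 - p ^ (j + 1))) Filter.atTop (nhds Q) := by
  have hs : Summable fun j : ℕ => ‖-p ^ (j + 1)‖ := by
    simp only [norm_neg, norm_pow]
    exact (summable_nat_add_iff 1).2 (summable_geometric_of_lt_one (norm_nonneg p) hp1)
  refine ⟨∏' j : ℕ, (1 + -p ^ (j + 1)), tprod_one_add_ne_zero_of_summable (fun j => ?_) hs, ?_⟩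
  · rw [← sub_eq_add_neg]; exact one_sub_pow_succ_ne_zero hp1 j
  · simpa only [sub_eq_add_neg] using
      (multipliable_one_add_of_summable hs).hasProd.tendsto_prod_nat

theorem tendsto_recipEuler {p Q : ℂ} (hQ : Q ≠ 0)
    (h : Filter.Tendsto (fun n : ℕ => ∏ j ∈ range n, (1 - p ^ (j + 1))) Filter.atTop (nhds Q)) :
    Filter.Tendsto (recipEuler p) Filter.atTop (nhds Q⁻¹) := by
  have h1 := (h.inv₀ hQ).comp
    (Filter.tendsto_atTop_atTop.2 fun b => ⟨(b : ℤ), fun m hm => (by omega : b ≤ m.toNat)⟩)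
  refine h1.congr' ?_
  filter_upwards [Filter.eventually_ge_atTop (0 : ℤ)] with m hm
  rw [recipEuler, if_neg (not_lt.2 hm)]
  rfl

theorem exists_norm_recipEuler_le {p Q : ℂ} (hQ : Q ≠ 0)
    (h : Filter.Tendsto (fun n : ℕ => ∏ j ∈ range n, (1 - p ^ (j + 1))) Filter.atTop (nhds Q)) :
    ∃ B : ℝ, 0 ≤ B ∧ ∀ m, ‖recipEuler p m‖ ≤ B := by
  obtain ⟨B, hB⟩ := (h.inv₀ hQ).norm.bddAbove_range
  have hB' : ∀ n : ℕ, ‖(∏ j ∈ range n, (1 - p ^ (j + 1)))⁻¹‖ ≤ B := fun n => hB ⟨n, rfl⟩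
  have hB0 : 0 ≤ B := (norm_nonneg _).trans (hB' 0)
  refine ⟨B, hB0, fun m => ?_⟩
  rw [recipEuler]
  split_ifs
  · simpa using hB0
  · exact hB' _

/-- The Jacobi triple product identity, up to the value of the constant. -/
theorem exists_ellTheta_eq_mul_tsum {p : ℂ} (hp : p ≠ 0) (hp1 : ‖p‖ < 1) :
    ∃ C : ℂ, ∀ z : ℂ, z ≠ 0 → ellTheta z p = C * ∑' k : ℤ, thetaTerm p (-z) k := by
  obtain ⟨Q, hQ, hlim⟩ := exists_tendsto_prod_one_sub_pow hp1
  refine ⟨Q⁻¹, fun z hz => ?_⟩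
  have hr := tendsto_recipEuler hQ hlim
  obtain ⟨B, hB0, hB⟩ := exists_norm_recipEuler_le hQ hlim
  obtain ⟨D, hD⟩ := hlim.norm.bddAbove_range
  have hD' : ∀ n : ℕ, ‖∏ j ∈ range n, (1 - p ^ (j + 1))‖ ≤ D := fun n => hD ⟨n, rfl⟩
  have hD0 : 0 ≤ D := (norm_nonneg _).trans (hD' 0)
  have hs := (summable_thetaTerm hp hp1 (neg_ne_zero.2 hz)).norm
  have h2 : Filter.Tendsto (fun N : ℕ => 2 * N) Filter.atTop Filter.atTop :=
    Filter.tendsto_id.const_mul_atTop' two_pos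
  -- The coefficients are bounded by `D * B * B` uniformly in `N` and `k`, and tend to `Q⁻¹` for
  -- each `k`.
  have key := tendsto_tsum_of_dominated_convergence
    (𝓕 := Filter.atTop) (f := fun (N : ℕ) (k : ℤ) => thetaTerm p (-z) k * centralQBinom p N k)
    (g := fun k => thetaTerm p (-z) k * (Q * Q⁻¹ * Q⁻¹))
    (bound := fun k => ‖thetaTerm p (-z) k‖ * (D * B * B)) (hs.mul_right _) ?_ ?_
  · simp only [fun N => (hasSum_thetaTerm_mul_centralQBinom hp hp1 hz N).tsum_eq] at key
    have h3 := (ellTheta_multipliable z p hp1).hasProd.tendsto_prod_nat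
    rw [ellTheta, tendsto_nhds_unique h3 key, tsum_mul_right, mul_inv_cancel₀ hQ, one_mul, mul_comm]
  · intro k
    refine Filter.Tendsto.const_mul _ (((hlim.comp h2).mul (hr.comp ?_)).mul (hr.comp ?_))
    · exact Filter.tendsto_atTop_add_const_right _ k tendsto_natCast_atTop_atTop
    · exact Filter.tendsto_atTop_add_const_right _ (-k) tendsto_natCast_atTop_atTop
  · refine .of_forall fun N k => ?_
    rw [norm_mul, centralQBinom, norm_mul, norm_mul]
    gcongr
    · exact hD' _
    · exact hB _
    · exact hB _

/-! ### Products of two theta series and the addition formula. -/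

/-- Splitting `ℤ × ℤ` according to the parity of the sum of the coordinates. -/
def parityEquiv : (ℤ × ℤ) ⊕ (ℤ × ℤ) ≃ ℤ × ℤ where
  toFun := Sum.elim (fun x => (x.1 + x.2, x.1 - x.2)) (fun x => (x.1 + x.2 + 1, x.1 - x.2))
  invFun x := if (x.1 + x.2) % 2 = 0
    then Sum.inl ((x.1 + x.2) / 2, (x.1 + x.2) / 2 - x.2)
    else Sum.inr ((x.1 + x.2) / 2, (x.1 + x.2) / 2 - x.2)
  left_inv := by
    rintro (⟨i, j⟩ | ⟨i, j⟩)
    · have h : (i + j + (i - j)) % 2 = 0 := by omega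
      simp only [Sum.elim_inl, h, if_true, Sum.inl.injEq, Prod.mk.injEq]
      omega
    · have h : ¬ (i + j + 1 + (i - j)) % 2 = 0 := by omega
      simp only [Sum.elim_inr, h, if_false, Sum.inr.injEq, Prod.mk.injEq]
      omega
  right_inv := by
    rintro ⟨m, n⟩
    by_cases h : (m + n) % 2 = 0
    · simp only [h, if_true, Sum.elim_inl, Prod.mk.injEq]
      omega
    · simp only [h, if_false, Sum.elim_inr, Prod.mk.injEq]
      omega

theorem thetaTerm_mul_left (p c w : ℂ) (k : ℤ) :
    thetaTerm p (c * w) k = c ^ k * thetaTerm p w k := by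
  rw [thetaTerm, thetaTerm, mul_zpow]
  ring

/-- The substitution `(i + j, i - j)` diagonalises the quadratic exponent, which separates `x` from
`y` and replaces `p` by `p²`. -/
theorem thetaTerm_mul_thetaTerm_even {p x y : ℂ} (hp : p ≠ 0) (hx : x ≠ 0) (hy : y ≠ 0)
    (i j : ℤ) :
    thetaTerm p (-(x * y)) (i + j) * thetaTerm p (-(x / y)) (i - j)
      = thetaTerm (p ^ 2) (x ^ 2) i * thetaTerm (p ^ 2) (p * y ^ 2) j := by
  have he : (i + j) * (i + j - 1) / 2 + (i - j) * (i - j - 1) / 2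
      = 2 * (i * (i - 1) / 2) + (2 * (j * (j - 1) / 2) + j) := by
    have h1 := two_mul_triangle (i + j)
    have h2 := two_mul_triangle (i - j)
    have h3 := two_mul_triangle i
    have h4 := two_mul_triangle j
    linarith
  have hu : -(x * y) ≠ 0 := neg_ne_zero.2 (mul_ne_zero hx hy)
  have hv : -(x / y) ≠ 0 := neg_ne_zero.2 (div_ne_zero hx hy)
  have e1 : x ^ 2 = -(x * y) * -(x / y) := by field_simp
  have e2 : y ^ 2 = -(x * y) / -(x / y) := by field_simp
  have hsq : ∀ k : ℤ, (p ^ 2) ^ k = p ^ (2 * k) := fun k => by rw [zpow_mul, zpow_ofNat]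
  have hpow : (-(x * y)) ^ (i + j) * (-(x / y)) ^ (i - j) = (x ^ 2) ^ i * (y ^ 2) ^ j := by
    rw [e1, e2, mul_zpow, div_zpow, zpow_add₀ hu, zpow_sub₀ hv]
    ring
  rw [thetaTerm_mul_left]
  simp only [thetaTerm]
  rw [mul_mul_mul_comm, hpow, ← zpow_add₀ hp, he, zpow_add₀ hp, zpow_add₀ hp, hsq, hsq]
  ring

theorem thetaTerm_mul_thetaTerm_odd {p x y : ℂ} (hp : p ≠ 0) (hx : x ≠ 0) (hy : y ≠ 0)
    (i j : ℤ) :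
    thetaTerm p (-(x * y)) (i + j + 1) * thetaTerm p (-(x / y)) (i - j)
      = -(x * y) * (thetaTerm (p ^ 2) (p * x ^ 2) i
        * thetaTerm (p ^ 2) (p * (p * y ^ 2)) j) := by
  rw [thetaTerm_add_one hp (neg_ne_zero.2 (mul_ne_zero hx hy)), mul_assoc,
    thetaTerm_mul_thetaTerm_even hp hx hy, thetaTerm_mul_left _ p (x ^ 2),
    thetaTerm_mul_left _ p (p * y ^ 2), zpow_add₀ hp]
  ring

/-- Shifting the index by one turns the even series in `x` into the same function as the odd series
in `y`; this makes the product formula antisymmetric, up to the prefactor. -/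
theorem tsum_thetaTerm_sq {p x : ℂ} (hp : p ≠ 0) (hx : x ≠ 0) :
    ∑' k : ℤ, thetaTerm (p ^ 2) (x ^ 2) k
      = x ^ 2 * ∑' k : ℤ, thetaTerm (p ^ 2) (p * (p * x ^ 2)) k := by
  rw [← (Equiv.addRight (1 : ℤ)).tsum_eq, ← tsum_mul_left]
  refine tsum_congr fun k => ?_
  rw [Equiv.coe_addRight, thetaTerm_add_one (pow_ne_zero 2 hp) (pow_ne_zero 2 hx), ← mul_assoc p p,
    ← sq, thetaTerm_mul_left]
  ring

theorem tsum_thetaTerm_mul_tsum_thetaTerm {p x y : ℂ} (hp : p ≠ 0) (hp1 : ‖p‖ < 1) (hx : x ≠ 0)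
    (hy : y ≠ 0) :
    (∑' k : ℤ, thetaTerm p (-(x * y)) k) * ∑' k : ℤ, thetaTerm p (-(x / y)) k
      = x * (x * (∑' k : ℤ, thetaTerm (p ^ 2) (p * (p * x ^ 2)) k)
          * (∑' k : ℤ, thetaTerm (p ^ 2) (p * y ^ 2) k)
        - (∑' k : ℤ, thetaTerm (p ^ 2) (p * x ^ 2) k)
          * (y * ∑' k : ℤ, thetaTerm (p ^ 2) (p * (p * y ^ 2)) k)) := by
  have hP : p ^ 2 ≠ 0 := pow_ne_zero 2 hp
  have hP1 : ‖p ^ 2‖ < 1 := by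
    rw [norm_pow]; exact pow_lt_one₀ (norm_nonneg p) hp1 two_ne_zero
  have hs : ∀ w : ℂ, w ≠ 0 → Summable fun k => ‖thetaTerm (p ^ 2) w k‖ :=
    fun w hw => (summable_thetaTerm hP hP1 hw).norm
  have s1 := hs _ (pow_ne_zero 2 hx)
  have s2 := hs _ (mul_ne_zero hp (pow_ne_zero 2 hy))
  have s3 := hs _ (mul_ne_zero hp (pow_ne_zero 2 hx))
  have s4 := hs _ (mul_ne_zero hp (mul_ne_zero hp (pow_ne_zero 2 hy)))
  have ev : ((fun z : ℤ × ℤ => thetaTerm p (-(x * y)) z.1 * thetaTerm p (-(x / y)) z.2)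
      ∘ parityEquiv) ∘ Sum.inl
      = fun z => thetaTerm (p ^ 2) (x ^ 2) z.1 * thetaTerm (p ^ 2) (p * y ^ 2) z.2 :=
    funext fun z => thetaTerm_mul_thetaTerm_even hp hx hy z.1 z.2
  have od : ((fun z : ℤ × ℤ => thetaTerm p (-(x * y)) z.1 * thetaTerm p (-(x / y)) z.2)
      ∘ parityEquiv) ∘ Sum.inr
      = fun z => -(x * y) * (thetaTerm (p ^ 2) (p * x ^ 2) z.1
        * thetaTerm (p ^ 2) (p * (p * y ^ 2)) z.2) :=
    funext fun z => thetaTerm_mul_thetaTerm_odd hp hx hy z.1 z.2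
  have h1 := (summable_mul_of_summable_norm s1 s2).hasSum
  have h2 := ((summable_mul_of_summable_norm s3 s4).hasSum).mul_left (-(x * y))
  rw [← tsum_mul_tsum_of_summable_norm s1 s2, ← ev] at h1
  rw [← tsum_mul_tsum_of_summable_norm s3 s4, ← od] at h2
  have h := (parityEquiv.hasSum_iff.1 (h1.sum h2)).tsum_eq
  rw [tsum_mul_tsum_of_summable_norm
    (summable_thetaTerm hp hp1 (neg_ne_zero.2 (mul_ne_zero hx hy))).norm
    (summable_thetaTerm hp hp1 (neg_ne_zero.2 (div_ne_zero hx hy))).norm, h,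
    tsum_thetaTerm_sq hp hx]
  ring

theorem ellTheta_zero_right (z : ℂ) : ellTheta z 0 = 1 - z := by
  rw [ellTheta, tprod_eq_mulSingle 0 fun j hj => by simp [hj]]
  simp

/-- The addition formula for the theta function. -/
theorem ellTheta_addition {p x y u v : ℂ} (hp1 : ‖p‖ < 1) (hx : x ≠ 0) (hy : y ≠ 0) (hu : u ≠ 0)
    (hv : v ≠ 0) :
    ellTheta (x * y) p * ellTheta (x / y) p * ellTheta (u * v) p * ellTheta (u / v) p
      - ellTheta (x * v) p * ellTheta (x / v) p * ellTheta (u * y) p * ellTheta (u / y) p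
      = u / y * (ellTheta (y * v) p * ellTheta (y / v) p * ellTheta (x * u) p
        * ellTheta (x / u) p) := by
  by_cases hp : p = 0
  · subst hp
    simp only [ellTheta_zero_right]
    field_simp
    ring
  obtain ⟨C, hC⟩ := exists_ellTheta_eq_mul_tsum hp hp1
  have key : ∀ s t : ℂ, s ≠ 0 → t ≠ 0 → ellTheta (s * t) p * ellTheta (s / t) p
      = C ^ 2 * (s * (s * (∑' k : ℤ, thetaTerm (p ^ 2) (p * (p * s ^ 2)) k)
          * (∑' k : ℤ, thetaTerm (p ^ 2) (p * t ^ 2) k)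
        - (∑' k : ℤ, thetaTerm (p ^ 2) (p * s ^ 2) k)
          * (t * ∑' k : ℤ, thetaTerm (p ^ 2) (p * (p * t ^ 2)) k))) := by
    intro s t hs ht
    rw [hC _ (mul_ne_zero hs ht), hC _ (div_ne_zero hs ht),
      ← tsum_thetaTerm_mul_tsum_thetaTerm hp hp1 hs ht]
    ring
  -- The unknown constant enters every product as `C ^ 4`, so its value is irrelevant.
  rw [mul_assoc (_ * _), mul_assoc (_ * _), mul_assoc (_ * _), key x y hx hy, key u v hu hv,
    key x v hx hv, key u y hu hy, key y v hy hv, key x u hx hu]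
  field_simp
  ring

/-- The reflection `k ↦ 1 - k` preserves the exponent `k(k-1)/2`. -/
theorem ellTheta_inv {p x : ℂ} (hp1 : ‖p‖ < 1) (hx : x ≠ 0) :
    ellTheta x⁻¹ p = -x⁻¹ * ellTheta x p := by
  by_cases hp : p = 0
  · subst hp
    simp only [ellTheta_zero_right]
    field_simp
    ring
  obtain ⟨C, hC⟩ := exists_ellTheta_eq_mul_tsum hp hp1
  rw [hC _ hx, hC _ (inv_ne_zero hx), mul_left_comm]
  congr 1
  rw [← (Equiv.subLeft (1 : ℤ)).tsum_eq, ← tsum_mul_left]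
  refine tsum_congr fun k => ?_
  have he : (1 - k) * (1 - k - 1) = k * (k - 1) := by ring
  rw [Equiv.subLeft_apply, thetaTerm, thetaTerm, he, ← inv_neg, inv_zpow', neg_sub,
    zpow_sub_one₀ (neg_ne_zero.2 hx)]
  ring

theorem ellTheta_one (p : ℂ) : ellTheta 1 p = 0 :=
  tprod_of_exists_eq_zero ⟨0, by simp⟩

/-- The addition formula reparametrised so that no square roots remain; the auxiliary `y = √(cd)`
cancels from every argument. -/
theorem ellTheta_three_param {p b c d t : ℂ} (hp1 : ‖p‖ < 1) (hb : b ≠ 0) (hc : c ≠ 0)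
    (hd : d ≠ 0) (ht : t ≠ 0) :
    ellTheta (b * c * d * t) p * ellTheta (b * t) p * ellTheta (c * t) p * ellTheta (d * t) p
      - ellTheta (b * c * t) p * ellTheta (b * d * t) p * ellTheta (c * d * t) p * ellTheta t p
      = t * (ellTheta c p * ellTheta d p * ellTheta (b * c * d * t ^ 2) p * ellTheta b p) := by
  obtain ⟨y, hy⟩ := IsSquare.exists_sq (c * d) (IsAlgClosed.exists_eq_mul_self (c * d))
  have hy0 : y ≠ 0 := by
    rintro rfl
    exact mul_ne_zero hc hd (by simpa using hy)
  have h := ellTheta_addition (p := p) (x := b * y * t) (y := y) (u := y * t) (v := c / y) hp1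
    (by positivity) hy0 (by positivity) (by positivity)
  have e1 : b * y * t * y = b * c * d * t := by linear_combination -b * t * hy
  have e2 : b * y * t / y = b * t := by field_simp
  have e3 : y * t * (c / y) = c * t := by field_simp
  have e4 : y * t / (c / y) = d * t := by field_simp; linear_combination -hy
  have e5 : b * y * t * (c / y) = b * c * t := by field_simp
  have e6 : b * y * t / (c / y) = b * d * t := by field_simp; linear_combination -hy
  have e7 : y * t * y = c * d * t := by linear_combination -t * hy
  have e8 : y * t / y = t := by field_simp
  have e9 : y * (c / y) = c := by field_simp
  have e10 : y / (c / y) = d := by field_simp; linear_combination -hy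
  have e11 : b * y * t * (y * t) = b * c * d * t ^ 2 := by linear_combination -b * t ^ 2 * hy
  have e12 : b * y * t / (y * t) = b := by field_simp
  rwa [e1, e2, e3, e4, e5, e6, e7, e8, e9, e10, e11, e12] at h

/-! ### Elliptic factorials and the telescoping sum. -/

theorem ellFactorial_zero (x q p : ℂ) : ellFactorial x q p 0 = 1 := by simp [ellFactorial]

theorem ellFactorial_succ (x q p : ℂ) (n : ℕ) :
    ellFactorial x q p (n + 1) = ellFactorial x q p n * ellTheta (x * q ^ n) p :=
  prod_range_succ _ _

theorem ellFactorial_succ' (x q p : ℂ) (n : ℕ) :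
    ellFactorial x q p (n + 1) = ellTheta x p * ellFactorial (x * q) q p n := by
  rw [ellFactorial, prod_range_succ', pow_zero, mul_one, mul_comm, ellFactorial]
  congr 1
  exact prod_congr rfl fun j _ => by rw [pow_succ', mul_assoc]

theorem ellFactorial_mul_ne_zero {x q p : ℂ} (h : ∀ j : ℕ, ellTheta (x * q ^ j) p ≠ 0) (n : ℕ) :
    ellFactorial (x * q) q p n ≠ 0 :=
  prod_ne_zero_iff.2 fun j _ => by rw [mul_assoc, ← pow_succ']; exact h _

theorem ellFactorial_self_ne_zero {q p : ℂ} (h : ∀ j : ℕ, ellTheta (q ^ (j + 1)) p ≠ 0) (n : ℕ) :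
    ellFactorial q q p n ≠ 0 :=
  prod_ne_zero_iff.2 fun j _ => by rw [← pow_succ']; exact h _

/-- The theta function identity behind the telescoping of the very-well-poised sum. -/
theorem ellTheta_telescope {a k q p : ℂ} (hp : ‖p‖ < 1) (hq : q ≠ 0) (ha : a ≠ 0) (hk : k ≠ 0)
    (M i j : ℕ) :
    ellTheta (k * q ^ (M + i)) p * ellTheta (k / a * q ^ i) p * ellTheta (a * q ^ (M + 2 * i + j)) p
        * ellTheta (q ^ j) p
      - k / a * (ellTheta (q ^ i) p * ellTheta (k * q ^ (M + 2 * i + j)) p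
        * ellTheta (a * q ^ (M + i)) p * ellTheta (a / k * q ^ j) p)
      = ellTheta (a * q ^ (M + i + j)) p * ellTheta (q ^ (i + j)) p * ellTheta (k * q ^ (M + 2 * i)) p
        * ellTheta (k / a) p := by
  have h := ellTheta_three_param (p := p) (b := k / a) (c := a * q ^ (M + i + j))
    (d := (q ^ (i + j))⁻¹) (t := q ^ i) hp (by positivity) (by positivity) (by positivity)
    (by positivity)
  have e1 : k / a * (a * q ^ (M + i + j)) * (q ^ (i + j))⁻¹ * q ^ i = k * q ^ (M + i) := by
    field_simp; ring
  have e2 : a * q ^ (M + i + j) * q ^ i = a * q ^ (M + 2 * i + j) := by ring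
  have e3 : (q ^ (i + j))⁻¹ * q ^ i = (q ^ j)⁻¹ := by field_simp; ring
  have e4 : k / a * (a * q ^ (M + i + j)) * q ^ i = k * q ^ (M + 2 * i + j) := by
    field_simp; ring
  have e5 : k / a * (q ^ (i + j))⁻¹ * q ^ i = (a / k * q ^ j)⁻¹ := by field_simp; ring
  have e6 : a * q ^ (M + i + j) * (q ^ (i + j))⁻¹ * q ^ i = a * q ^ (M + i) := by
    field_simp; ring
  have e7 : k / a * (a * q ^ (M + i + j)) * (q ^ (i + j))⁻¹ * (q ^ i) ^ 2
      = k * q ^ (M + 2 * i) := by field_simp; ring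
  rw [e1, e2, e3, e4, e5, e6, e7, ellTheta_inv hp (by positivity), ellTheta_inv hp (by positivity),
    ellTheta_inv hp (by positivity)] at h
  have e8 : q ^ i * (q ^ (i + j))⁻¹ = (q ^ j)⁻¹ := by field_simp; ring
  have e9 : (a / k * q ^ j)⁻¹ = (q ^ j)⁻¹ * (k / a) := by field_simp
  rw [e9] at h
  -- The three inverted arguments leave the common factor `-(q^j)⁻¹`.
  refine mul_left_cancel₀ (neg_ne_zero.2 (inv_ne_zero (pow_ne_zero j hq))) ?_
  rw [← e8] at h ⊢
  linear_combination h

/-- The summand of the orthogonality sum, up to a factor independent of the summation index. -/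
noncomputable def baileyTerm (a k q p : ℂ) (M i j : ℕ) : ℂ :=
  ellTheta (k * q ^ (M + 2 * i)) p / ellTheta k p
    * (ellFactorial (a / k) q p j / ellFactorial q q p j)
    * (ellFactorial a q p (M + 2 * i + j) / ellFactorial (k * q) q p (M + 2 * i + j))
    * (k / a) ^ j
    * (ellFactorial (k / a) q p i / ellFactorial q q p i
      * (ellFactorial k q p (M + i) / ellFactorial (a * q) q p (M + i)))

/-- The closed form of the partial sums of `baileyTerm`. -/
noncomputable def baileyPartial (a k q p : ℂ) (M i j : ℕ) : ℂ :=
  ellFactorial (k * q) q p (M + i) * ellFactorial (k / a * q) q p i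
    * ellFactorial a q p (M + 2 * i + j + 1) * ellFactorial (a / k) q p j * ellTheta (q ^ j) p
    * (k / a) ^ j
    / (ellFactorial q q p i * ellFactorial q q p j * ellFactorial (k * q) q p (M + 2 * i + j)
      * ellFactorial (a * q) q p (M + i) * ellTheta (a * q ^ (M + i + j)) p
      * ellTheta (q ^ (i + j)) p)

/-- The index `j + 1` matters: at `i = j = 0` the closed form has `θ(1) = 0` in its denominator. -/
theorem baileyPartial_zero {a k q p : ℂ}
    (hθq : ∀ j : ℕ, ellTheta (q ^ (j + 1)) p ≠ 0)
    (hθa : ∀ j : ℕ, ellTheta (a * q ^ j) p ≠ 0)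
    (hθk : ∀ j : ℕ, ellTheta (k * q ^ j) p ≠ 0)
    (M j : ℕ) :
    baileyPartial a k q p M 0 (j + 1) = baileyTerm a k q p M 0 (j + 1) := by
  have hk0 : ellTheta k p ≠ 0 := by simpa using hθk 0
  have h1 := ellFactorial_succ' k q p M
  rw [ellFactorial_succ] at h1
  have hj := hθq j
  have hA := hθa (M + (j + 1))
  have hqj := ellFactorial_self_ne_zero hθq (j + 1)
  have hK := ellFactorial_mul_ne_zero hθk (M + (j + 1))
  have hD := ellFactorial_mul_ne_zero hθa M
  rw [baileyPartial, baileyTerm]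
  simp only [mul_zero, add_zero, zero_add, ellFactorial_zero]
  rw [ellFactorial_succ a q p (M + (j + 1))]
  generalize ellFactorial (a * q) q p M = D at *
  generalize ellFactorial (a / k) q p (j + 1) = P
  generalize ellFactorial a q p (M + (j + 1)) = A
  generalize k / a = κ at *
  field_simp
  linear_combination -(A * P * κ ^ (j + 1)) * h1

/-- Once the common factorials are split off, what remains is `ellTheta_telescope` at `i + 1`. -/
theorem baileyPartial_succ {a k q p : ℂ} (hp : ‖p‖ < 1) (hq : q ≠ 0) (ha : a ≠ 0) (hk : k ≠ 0)
    (hθq : ∀ j : ℕ, ellTheta (q ^ (j + 1)) p ≠ 0)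
    (hθa : ∀ j : ℕ, ellTheta (a * q ^ j) p ≠ 0)
    (hθk : ∀ j : ℕ, ellTheta (k * q ^ j) p ≠ 0)
    (M i j : ℕ) :
    baileyPartial a k q p M i (j + 1) + baileyTerm a k q p M (i + 1) j
      = baileyPartial a k q p M (i + 1) j := by
  have hk0 : ellTheta k p ≠ 0 := by simpa using hθk 0
  have star := ellTheta_telescope (p := p) hp hq ha hk M (i + 1) j
  have n1 : M + 2 * (i + 1) + j = M + 2 * i + (j + 1) + 1 := by ring
  have n2 : M + (i + 1) + j = M + i + (j + 1) := by ring
  have n3 : i + 1 + j = i + (j + 1) := by ring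
  rw [baileyPartial, baileyTerm, baileyPartial]
  rw [n1, n2, n3, ← add_assoc M i 1] at star ⊢
  have hA := hθa (M + i + (j + 1))
  have hq1 : ellTheta (q ^ (i + (j + 1))) p ≠ 0 := hθq (i + j)
  have hqi := ellFactorial_self_ne_zero hθq i
  have hqj := ellFactorial_self_ne_zero hθq j
  have hK := ellFactorial_mul_ne_zero hθk (M + 2 * i + (j + 1))
  have hD := ellFactorial_mul_ne_zero hθa (M + i)
  have hqi1 := hθq i
  have hqj1 := hθq j
  have hK1 := hθk (M + 2 * i + (j + 1) + 1)
  have hD1 := hθa (M + i + 1)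
  have e1 : ∀ (x : ℂ) (n : ℕ), x * q * q ^ n = x * q ^ (n + 1) := fun x n => by ring
  have e2 : ∀ n : ℕ, q * q ^ n = q ^ (n + 1) := fun n => by ring
  rw [ellFactorial_succ' (k / a), ellFactorial_succ' k, ellFactorial_succ (a / k),
    ellFactorial_succ q q p i, ellFactorial_succ q q p j, ellFactorial_succ (k * q) q p (M + i),
    ellFactorial_succ (a * q) q p (M + i), ellFactorial_succ (k / a * q),
    ellFactorial_succ (k * q) q p (M + 2 * i + (j + 1)),
    ellFactorial_succ a q p (M + 2 * i + (j + 1) + 1), e1, e1, e1, e1, e2, e2, pow_succ (k / a) j]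
  generalize ellFactorial (a * q) q p (M + i) = D at *
  generalize ellFactorial (k / a * q) q p i = B
  generalize ellFactorial (k * q) q p (M + i) = K
  generalize ellFactorial (a / k) q p j = P
  generalize ellFactorial a q p (M + 2 * i + (j + 1) + 1) = A
  generalize ellTheta (a / k * q ^ j) p = T at *
  generalize k / a = κ at *
  field_simp
  linear_combination -(K * B * A * P * κ ^ j) * star

theorem sum_baileyTerm {a k q p : ℂ} (hp : ‖p‖ < 1) (hq : q ≠ 0) (ha : a ≠ 0) (hk : k ≠ 0)
    (hθq : ∀ j : ℕ, ellTheta (q ^ (j + 1)) p ≠ 0)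
    (hθa : ∀ j : ℕ, ellTheta (a * q ^ j) p ≠ 0)
    (hθk : ∀ j : ℕ, ellTheta (k * q ^ j) p ≠ 0)
    (M N : ℕ) {i : ℕ} (hi : i ≤ N + 1) :
    ∑ s ∈ range (i + 1), baileyTerm a k q p M s (N + 1 - s)
      = baileyPartial a k q p M i (N + 1 - i) := by
  induction i with
  | zero => simp [baileyPartial_zero hθq hθa hθk]
  | succ i ih =>
    rw [sum_range_succ, ih (by omega), ← baileyPartial_succ hp hq ha hk hθq hθa hθk]
    congr 2
    omega

theorem sum_baileyTerm_eq_zero {a k q p : ℂ} (hp : ‖p‖ < 1) (hq : q ≠ 0) (ha : a ≠ 0) (hk : k ≠ 0)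
    (hθq : ∀ j : ℕ, ellTheta (q ^ (j + 1)) p ≠ 0)
    (hθa : ∀ j : ℕ, ellTheta (a * q ^ j) p ≠ 0)
    (hθk : ∀ j : ℕ, ellTheta (k * q ^ j) p ≠ 0)
    (M N : ℕ) :
    ∑ s ∈ range (N + 1 + 1), baileyTerm a k q p M s (N + 1 - s) = 0 := by
  rw [sum_baileyTerm hp hq ha hk hθq hθa hθk M N le_rfl, Nat.sub_self, baileyPartial, pow_zero,
    ellTheta_one]
  simp

/-! ### Matrix inversion and the transform. -/

/-- Inversion of lower triangular matrices, from a left inverse. -/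
theorem triangular_inversion {F G : ℕ → ℕ → ℂ}
    (h : ∀ m N, ∑ s ∈ range (N + 1), G (m + N) (m + s) * F (m + s) m = if N = 0 then 1 else 0)
    (α β : ℕ → ℂ) :
    (∀ n, β n = ∑ r ∈ range (n + 1), F n r * α r) ↔
      ∀ n, α n = ∑ r ∈ range (n + 1), G n r * β r := by
  have forward : ∀ α' β' : ℕ → ℂ, (∀ n, β' n = ∑ r ∈ range (n + 1), F n r * α' r) →
      ∀ n, α' n = ∑ r ∈ range (n + 1), G n r * β' r := by
    intro α' β' hβ n
    simp only [hβ, mul_sum, range_eq_Ico]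
    -- After the interchange of sums, only the column `m = n` survives.
    rw [← sum_Ico_Ico_comm, ← range_eq_Ico, sum_range_succ, sum_eq_zero, zero_add]
    · have h1 := h n 0
      simp only [zero_add, sum_range_one, add_zero, if_true] at h1
      rw [Nat.Ico_succ_singleton, sum_singleton, ← mul_assoc, h1, one_mul]
    · intro m hm
      have hm' : m < n := mem_range.1 hm
      have h1 := h m (n - m)
      rw [Nat.add_sub_cancel' hm'.le, if_neg (by omega)] at h1
      rw [sum_Ico_eq_sum_range, Nat.sub_add_comm hm'.le]
      simp only [← mul_assoc]
      rw [← sum_mul, h1, zero_mul]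
  refine ⟨forward α β, fun hα n => ?_⟩
  -- Converse: `G β = α = G (F α)`. By strong induction the terms with `r < n` agree, and the
  -- diagonal entry of `G` is nonzero, hence cancels.
  have h2 := forward α (fun n => ∑ r ∈ range (n + 1), F n r * α r) fun n => rfl
  induction n using Nat.strong_induction_on with
  | _ n ih =>
    have h3 := (hα n).symm.trans (h2 n)
    have h4 : ∑ r ∈ range n, G n r * β r
        = ∑ r ∈ range n, G n r * ∑ s ∈ range (r + 1), F r s * α s :=
      sum_congr rfl fun r hr => by rw [ih r (mem_range.1 hr)]
    rw [sum_range_succ, sum_range_succ _ n, h4] at h3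
    have h1 := h n 0
    simp only [zero_add, sum_range_one, add_zero, if_true] at h1
    exact mul_left_cancel₀ (left_ne_zero_of_mul_eq_one h1) (add_left_cancel h3)

theorem baileyTerm_diag {a k q p : ℂ}
    (hθa : ∀ j : ℕ, ellTheta (a * q ^ j) p ≠ 0)
    (hθk : ∀ j : ℕ, ellTheta (k * q ^ j) p ≠ 0) (M : ℕ) :
    ellTheta (a * q ^ M) p / ellTheta a p * baileyTerm a k q p M 0 0 = 1 := by
  have hk0 : ellTheta k p ≠ 0 := by simpa using hθk 0
  have ha0 : ellTheta a p ≠ 0 := by simpa using hθa 0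
  have h1 := ellFactorial_succ' k q p M
  have h2 := ellFactorial_succ' a q p M
  rw [ellFactorial_succ] at h1 h2
  have hK := ellFactorial_mul_ne_zero hθk M
  have hD := ellFactorial_mul_ne_zero hθa M
  simp only [baileyTerm, mul_zero, add_zero, ellFactorial_zero, pow_zero, div_one, mul_one, one_mul]
  generalize ellFactorial (a * q) q p M = D at *
  generalize ellFactorial (k * q) q p M = K at *
  generalize ellTheta (k * q ^ M) p = T at *
  field_simp
  linear_combination (ellFactorial k q p M * T) * h2
    + ellTheta a p * D * h1

theorem lemma3p1 (a k q p : ℂ) (hp : ‖p‖ < 1) (hq : q ≠ 0) (ha : a ≠ 0) (hk : k ≠ 0)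
    (hθq : ∀ j : ℕ, ellTheta (q ^ (j + 1)) p ≠ 0)
    (hθa : ∀ j : ℕ, ellTheta (a * q ^ j) p ≠ 0)
    (hθk : ∀ j : ℕ, ellTheta (k * q ^ j) p ≠ 0)
    (α β : ℕ → ℂ) :
    (∀ n : ℕ, β n = ∑ r ∈ Finset.range (n + 1),
        ellFactorial (k / a) q p (n - r) / ellFactorial q q p (n - r)
          * (ellFactorial k q p (n + r) / ellFactorial (a * q) q p (n + r)) * α r)
    ↔
    (∀ n : ℕ, α n = ellTheta (a * q ^ (2 * n)) p / ellTheta a p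
        * ∑ r ∈ Finset.range (n + 1),
          ellTheta (k * q ^ (2 * r)) p / ellTheta k p
            * (ellFactorial (a / k) q p (n - r) / ellFactorial q q p (n - r))
            * (ellFactorial a q p (n + r) / ellFactorial (k * q) q p (n + r))
            * (k / a) ^ (n - r) * β r) := by
  simp only [mul_sum, ← mul_assoc (ellTheta (a * q ^ _) p / ellTheta a p) _ (β _)]
  refine triangular_inversion (F := fun n r =>
      ellFactorial (k / a) q p (n - r) / ellFactorial q q p (n - r)
        * (ellFactorial k q p (n + r) / ellFactorial (a * q) q p (n + r)))
    (G := fun n r => ellTheta (a * q ^ (2 * n)) p / ellTheta a p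
      * (ellTheta (k * q ^ (2 * r)) p / ellTheta k p
        * (ellFactorial (a / k) q p (n - r) / ellFactorial q q p (n - r))
        * (ellFactorial a q p (n + r) / ellFactorial (k * q) q p (n + r))
        * (k / a) ^ (n - r))) ?_ α β
  intro m N
  -- With `M = 2m`, `i = s`, `j = N - s`, the product of entries is a `baileyTerm` times a factor
  -- free of `s`.
  have key : ∀ s ∈ range (N + 1), ellTheta (a * q ^ (2 * (m + N))) p / ellTheta a p
      * (ellTheta (k * q ^ (2 * (m + s))) p / ellTheta k p
        * (ellFactorial (a / k) q p (m + N - (m + s)) / ellFactorial q q p (m + N - (m + s)))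
        * (ellFactorial a q p (m + N + (m + s)) / ellFactorial (k * q) q p (m + N + (m + s)))
        * (k / a) ^ (m + N - (m + s)))
      * (ellFactorial (k / a) q p (m + s - m) / ellFactorial q q p (m + s - m)
        * (ellFactorial k q p (m + s + m) / ellFactorial (a * q) q p (m + s + m)))
      = ellTheta (a * q ^ (2 * (m + N))) p / ellTheta a p
        * baileyTerm a k q p (2 * m) s (N - s) := by
    intro s hs
    have hs' := mem_range.1 hs
    have e1 : m + N - (m + s) = N - s := by omega
    have e2 : m + N + (m + s) = 2 * m + 2 * s + (N - s) := by omega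
    have e3 : m + s - m = s := by omega
    have e4 : m + s + m = 2 * m + s := by omega
    rw [e1, e2, e3, e4, baileyTerm, mul_add 2 m s]
    ring
  rw [sum_congr rfl key, ← mul_sum]
  cases N with
  | zero =>
    rw [if_pos rfl, zero_add, sum_range_one, add_zero, Nat.sub_zero]
    exact baileyTerm_diag hθa hθk (2 * m)
  | succ N =>
    rw [sum_baileyTerm_eq_zero hp hq ha hk hθq hθa hθk, mul_zero, if_neg N.succ_ne_zero]
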